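/- Let $p\in[1,\infty)$. For $d\ge 1$ let $M_d^p=L(\ell^p_d)$ be the algebra of complex $d\times d$ matrices with the operator norm coming from $\ell^p_d=\ell^p(\{1,\dots,d\})$. Call a unital homomorphism $\rho\colon M_d^p\to L(L^p(Y,\nu))$ spatial if $\|\rho(a)\|\le\|a\|$ for all $a$. Given integers $d(n)\ge 2$, probability spaces $(Y_n,\nu_n)$ and unital homomorphisms $\rho_n\colon M_{d(n)}^p\to L(L^p(Y_n,\nu_n))$ for $n=1,2,\dots$, put $(Y,\nu)=\prod_n (Y_n,\nu_n)$, and let $A(d,\rho)\subset L(L^p(Y,\nu))$ be the norm closure of $\bigcup_n A_n$, where $A_n$ is the algebra generated by the operators $\rho_1(a_1)\otimes\cdots\otimes\rho_n(a_n)\otimes 1$ with $a_i\in M_{d(i)}$. A unital subalgebra $A\subset L(L^p(X,\mu))$, with $(X,\mu)$ a $\sigma$-finite measure space, is a spatial $L^p$ UHF algebra if it is isometrically isomorphic to $A(d,\rho)$ for some such choice in which every $\rho_n$ is spatial. Theorem. Let $p\in[1,\infty)$, and let $A\subset L(L^p(X,\mu))$ be a spatial $L^p$ UHF algebra, where $(X,\mu)$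 is $\sigma$-finite. Then $A$ is a Banach algebra (that is, complete), and it is amenable: for every Banach $A$-bimodule $E$, every bounded derivation from $A$ to the dual bimodule $E^*$ is inner. Moreover $A$ is $1$-amenable: there is a net $(m_\alpha)$ in the completed projective tensor product $A\mathbin{\widehat\otimes}A$ with $\|m_\alpha\|\le 1$ for all $\alpha$ such that, for every $a\in A$, $a\cdot m_\alpha-m_\alpha\cdot a\to 0$ and $a\,\pi(m_\alpha)\to a$, where $\pi\colon A\mathbin{\widehat\otimes}A\to A$ is the product map. -/

import Mathlib

open MeasureTheory ProbabilityTheory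
open scoped ENNReal TensorProduct Topology

universe u v w

noncomputable section

/-! ## Amenable Banach algebras -/

/-- A Banach bimodule structure over `A` on `E`, given by its two actions as bounded bilinear maps:
`lact a x` is `a · x` and `ract a x` is `x · a`.  The unit of `A` need not act as the identity. -/
structure BanachBimodule (A : Type u) [NormedRing A] [NormedAlgebra ℂ A]
    (E : Type w) [NormedAddCommGroup E] [NormedSpace ℂ E] where
  lact : A →L[ℂ] E →L[ℂ] E
  ract : A →L[ℂ] E →L[ℂ] E
  lact_mul : ∀ (a b : A) (x : E), lact (a * b) x = lact a (lact b x)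
  ract_mul : ∀ (a b : A) (x : E), ract (a * b) x = ract b (ract a x)
  lact_ract : ∀ (a b : A) (x : E), lact a (ract b x) = ract b (lact a x)

namespace BanachBimodule

variable {A : Type u} [NormedRing A] [NormedAlgebra ℂ A]
  {E : Type w} [NormedAddCommGroup E] [NormedSpace ℂ E]

/-- The left action on the dual module: `(a · φ)(x) = φ(x · a)`. -/
def dualL (M : BanachBimodule A E) (a : A) (φ : StrongDual ℂ E) : StrongDual ℂ E :=
  φ.comp (M.ract a)

/-- The right action on the dual module: `(φ · a)(x) = φ(a · x)`. -/
def dualR (M : BanachBimodule A E) (a : A) (φ : StrongDual ℂ E) : StrongDual ℂ E :=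
  φ.comp (M.lact a)

end BanachBimodule

/-- `A` is amenable: for every Banach `A`-bimodule `E`, every bounded derivation from `A` to
the dual bimodule of `E` is inner. -/
def IsAmenable (A : Type u) [NormedRing A] [NormedAlgebra ℂ A] : Prop :=
  ∀ (E : Type w) [NormedAddCommGroup E] [NormedSpace ℂ E] [CompleteSpace E]
    (M : BanachBimodule A E) (D : A →L[ℂ] StrongDual ℂ E),
    (∀ a b : A, D (a * b) = M.dualL a (D b) + M.dualR b (D a)) →
      ∃ φ : StrongDual ℂ E, ∀ a : A, D a = M.dualL a φ - M.dualR a φ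

/-! ## The projective tensor product and `C`-amenability -/

/-- The algebraic tensor product `A ⊗ A`, to be normed by the projective tensor norm. -/
def AlgTensor (A : Type u) [NormedRing A] [NormedAlgebra ℂ A] : Type u := A ⊗[ℂ] A

namespace AlgTensor

variable {A : Type u} [NormedRing A] [NormedAlgebra ℂ A]

instance : AddCommGroup (AlgTensor A) := inferInstanceAs (AddCommGroup (A ⊗[ℂ] A))

instance : Module ℂ (AlgTensor A) := inferInstanceAs (Module ℂ (A ⊗[ℂ] A))

/-- The elementary tensor `a ⊗ b`. -/
def tmul (a b : A) : AlgTensor A := a ⊗ₜ[ℂ] b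

/-- All values `∑ ‖aᵢ‖ ‖bᵢ‖` over the finite representations `t = ∑ aᵢ ⊗ bᵢ`. -/
def costs (t : AlgTensor A) : Set ℝ :=
  {r | ∃ (n : ℕ) (a b : Fin n → A), t = ∑ i, tmul (a i) (b i) ∧ r = ∑ i, ‖a i‖ * ‖b i‖}

/-- The projective tensor norm `inf {∑ ‖aᵢ‖ ‖bᵢ‖ : t = ∑ aᵢ ⊗ bᵢ}`. -/
def projNorm (t : AlgTensor A) : ℝ := sInf (costs t)

theorem costs_nonneg {t : AlgTensor A} {r : ℝ} (h : r ∈ costs t) : 0 ≤ r := by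
  obtain ⟨n, a, b, -, rfl⟩ := h
  positivity

theorem costs_bddBelow (t : AlgTensor A) : BddBelow (costs t) :=
  ⟨0, fun _ h => costs_nonneg h⟩

theorem costs_add {s t : AlgTensor A} {q r : ℝ} (hs : q ∈ costs s) (ht : r ∈ costs t) :
    q + r ∈ costs (s + t) := by
  obtain ⟨m, a, b, rfl, rfl⟩ := hs
  obtain ⟨n, c, d, rfl, rfl⟩ := ht
  refine ⟨m + n, Fin.append a c, Fin.append b d, ?_, ?_⟩ <;> simp [Fin.sum_univ_add]

theorem costs_nonempty (t : AlgTensor A) : (costs t).Nonempty := by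
  induction t using TensorProduct.induction_on with
  | zero => exact ⟨0, 0, Fin.elim0, Fin.elim0, by simp; rfl, by simp⟩
  | tmul x y => exact ⟨‖x‖ * ‖y‖, 1, fun _ => x, fun _ => y, by simp; rfl, by simp⟩
  | add x y hx hy =>
    obtain ⟨q, hq⟩ := hx
    obtain ⟨r, hr⟩ := hy
    exact ⟨q + r, costs_add hq hr⟩

theorem tmul_neg (a b : A) : tmul (-a) b = -tmul a b := TensorProduct.neg_tmul a b

theorem costs_neg {t : AlgTensor A} {r : ℝ} (h : r ∈ costs t) : r ∈ costs (-t) := by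
  obtain ⟨n, a, b, rfl, rfl⟩ := h
  exact ⟨n, fun i => -a i, b, by simp [tmul_neg, Finset.sum_neg_distrib], by simp⟩

/-- The projective tensor norm as a seminorm on the additive group `A ⊗ A`. -/
def projSeminorm : AddGroupSeminorm (AlgTensor A) where
  toFun := projNorm
  map_zero' := by
    refine le_antisymm (csInf_le (costs_bddBelow _) ?_)
      (le_csInf (costs_nonempty _) fun _ h => costs_nonneg h)
    exact ⟨0, Fin.elim0, Fin.elim0, by simp, by simp⟩
  add_le' s t := by
    refine le_of_forall_pos_le_add fun ε hε => ?_
    obtain ⟨q, hq, hq'⟩ := exists_lt_of_csInf_lt (costs_nonempty s)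
      (lt_add_of_pos_right (sInf (costs s)) (half_pos hε))
    obtain ⟨r, hr, hr'⟩ := exists_lt_of_csInf_lt (costs_nonempty t)
      (lt_add_of_pos_right (sInf (costs t)) (half_pos hε))
    have := csInf_le (costs_bddBelow _) (costs_add hq hr)
    simp only [projNorm]
    linarith
  neg' t := by
    refine congrArg sInf (Set.ext fun r => ⟨fun h => ?_, costs_neg⟩)
    simpa using costs_neg h

instance : SeminormedAddCommGroup (AlgTensor A) := projSeminorm.toSeminormedAddCommGroup

/-- The left action `a · (b ⊗ c) = ab ⊗ c` on `A ⊗ A`. -/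
def actL (a : A) : AlgTensor A →ₗ[ℂ] AlgTensor A :=
  TensorProduct.map (LinearMap.mulLeft ℂ a) LinearMap.id

/-- The right action `(b ⊗ c) · a = b ⊗ ca` on `A ⊗ A`. -/
def actR (a : A) : AlgTensor A →ₗ[ℂ] AlgTensor A :=
  TensorProduct.map LinearMap.id (LinearMap.mulRight ℂ a)

/-- The product map `a ⊗ b ↦ ab` on `A ⊗ A`. -/
def prodMap : AlgTensor A →ₗ[ℂ] A := LinearMap.mul' ℂ A

end AlgTensor

/-- The completed projective tensor product of `A` with itself. -/
abbrev ProjTensor (A : Type u) [NormedRing A] [NormedAlgebra ℂ A] : Type u :=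
  UniformSpace.Completion (AlgTensor A)

namespace ProjTensor

variable {A : Type u} [NormedRing A] [NormedAlgebra ℂ A]

/-- The left action of `A` on the projective tensor product, extended by continuity. -/
def actL (a : A) : ProjTensor A → ProjTensor A :=
  UniformSpace.Completion.map (AlgTensor.actL a)

/-- The right action of `A` on the projective tensor product, extended by continuity. -/
def actR (a : A) : ProjTensor A → ProjTensor A :=
  UniformSpace.Completion.map (AlgTensor.actR a)

/-- The product map from the projective tensor product to `A`, extended by continuity. -/
def prodMap : ProjTensor A → A :=
  UniformSpace.Completion.extension (AlgTensor.prodMap (A := A))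

end ProjTensor

/-- `A` is `C`-amenable: it has an approximate diagonal bounded by `C`, that is, a net `m` in the
completed projective tensor product with `‖m i‖ ≤ C`, `a · m i - m i · a → 0` and
`a π(m i) → a` for every `a`, where `π` is the product map. -/
def IsCAmenable (C : ℝ) (A : Type u) [NormedRing A] [NormedAlgebra ℂ A] : Prop :=
  ∃ (ι : Type u) (_ : Preorder ι) (_ : IsDirected ι (· ≤ ·)) (_ : Nonempty ι)
    (m : ι → ProjTensor A),
    (∀ i, ‖m i‖ ≤ C) ∧
    (∀ a : A, Filter.Tendsto (fun i => ProjTensor.actL a (m i) - ProjTensor.actR a (m i))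
      Filter.atTop (𝓝 0)) ∧
    (∀ a : A, Filter.Tendsto (fun i => a * ProjTensor.prodMap (m i)) Filter.atTop (𝓝 a))

/-! ## Spatial representations of matrix algebras -/

/-- The bounded operators on `L^p(X, μ)`. -/
abbrev LpOp (p : ℝ≥0∞) [Fact (1 ≤ p)] {X : Type u} [MeasurableSpace X] (μ : Measure X) : Type u :=
  Lp ℂ p μ →L[ℂ] Lp ℂ p μ

/-- The algebra of `d × d` complex matrices with the operator norm from `l^p` on `d` points. -/
abbrev MatLp (p : ℝ≥0∞) [Fact (1 ≤ p)] (d : ℕ) : Type :=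
  PiLp p (fun _ : Fin d => ℂ) →L[ℂ] PiLp p (fun _ : Fin d => ℂ)

/-- A (unital) representation of the matrix algebra on `L^p(X, μ)` is spatial if it is
contractive for the operator norm on `l^p_d`. -/
def IsSpatialRep {p : ℝ≥0∞} [Fact (1 ≤ p)] {X : Type u} [MeasurableSpace X] {μ : Measure X}
    {d : ℕ} (ρ : MatLp p d →ₐ[ℂ] LpOp p μ) : Prop :=
  ∀ a, ‖ρ a‖ ≤ ‖a‖

/-! ## Infinite tensor products -/

section Tensor

variable {p : ℝ≥0∞} [Fact (1 ≤ p)] {X : ℕ → Type v} [∀ n, MeasurableSpace (X n)]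
  {μ : ∀ n, Measure (X n)} [∀ n, IsProbabilityMeasure (μ n)]

theorem memLp_elemTensor (G : Finset ℕ) (ξ : ∀ n, Lp ℂ p (μ n)) :
    MemLp (fun x : ∀ n, X n => ∏ i ∈ G, ξ i (x i)) p (Measure.infinitePi μ) := by
  have hm : ∀ n, Measurable (ξ n) := fun n => (Lp.stronglyMeasurable (ξ n)).measurable
  have hLp : ∀ n, MemLp (fun x : ∀ n, X n => ξ n (x n)) p (Measure.infinitePi μ) := fun n =>
    (Lp.memLp (ξ n)).comp_measurePreserving (measurePreserving_eval_infinitePi μ n)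
  have hmeas : Measurable (fun x : ∀ n, X n => ∏ i ∈ G, ξ i (x i)) :=
    Finset.measurable_fun_prod G fun i _ => (hm i).comp (measurable_pi_apply i)
  have hp0 : p ≠ 0 := (zero_lt_one.trans_le (Fact.out : 1 ≤ p)).ne'
  by_cases hp : p = ∞
  · subst hp
    clear hmeas
    induction G using Finset.cons_induction with
    | empty => simpa using memLp_const (1 : ℂ)
    | cons j s hj ih =>
      simp only [Finset.prod_cons]
      exact ih.mul (hLp j)
  · refine ⟨hmeas.aestronglyMeasurable, ?_⟩
    rw [eLpNorm_lt_top_iff_lintegral_rpow_enorm_lt_top hp0 hp]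
    have hind : iIndepFun (fun (i : ℕ) (x : ∀ n, X n) => ‖ξ i (x i)‖ₑ ^ p.toReal)
        (Measure.infinitePi μ) :=
      iIndepFun_infinitePi (X := fun i y => ‖ξ i y‖ₑ ^ p.toReal)
        fun i => (hm i).enorm.pow_const _
    have hprod : ∀ x : ∀ n, X n, ‖∏ i ∈ G, ξ i (x i)‖ₑ ^ p.toReal
        = ∏ i ∈ G, ‖ξ i (x i)‖ₑ ^ p.toReal := fun x => by
      rw [ENNReal.prod_rpow_of_nonneg ENNReal.toReal_nonneg]
      congr 1
      simp [enorm_eq_nnnorm, nnnorm_prod]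
    simp only [hprod]
    rw [lintegral_prod_eq_prod_lintegral_of_indepFun G _ hind
      fun i => ((hm i).comp (measurable_pi_apply i)).enorm.pow_const _]
    refine ENNReal.prod_lt_top fun i _ => ?_
    exact (eLpNorm_lt_top_iff_lintegral_rpow_enorm_lt_top hp0 hp).1 (hLp i).2

/-- The elementary tensor in `L^p(∏ Xₙ, ∏ μₙ)`: the function `x ↦ ∏_{i ∈ G} ξᵢ(xᵢ)`, where `G` is
a finite set of coordinates. -/
def elemTensor (G : Finset ℕ) (ξ : ∀ n, Lp ℂ p (μ n)) : Lp ℂ p (Measure.infinitePi μ) :=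
  (memLp_elemTensor G ξ).toLp _

/-- `S` is the operator `(⨂_{i ∈ F} Tᵢ) ⊗ 1` on `L^p(∏ Xₙ, ∏ μₙ)`, that is, the bounded operator
which sends `⨂_{i ∈ G} ξᵢ` to `⨂_{i ∈ G} ηᵢ`, with `ηᵢ = Tᵢ ξᵢ` for `i ∈ F` and `ηᵢ = ξᵢ`
otherwise, for every finite set `G ⊇ F` of coordinates. -/
def IsTensorOp (F : Finset ℕ) (T : ∀ n, LpOp p (μ n)) (S : LpOp p (Measure.infinitePi μ)) : Prop :=
  ∀ G : Finset ℕ, F ⊆ G → ∀ ξ : ∀ n, Lp ℂ p (μ n),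
    S (elemTensor G ξ) = elemTensor G (fun i => if i ∈ F then T i (ξ i) else ξ i)

variable {d : ℕ → ℕ} (ρ : ∀ n, MatLp p (d n) →ₐ[ℂ] LpOp p (μ n))

/-- The image in `L(L^p(∏ Xₙ, ∏ μₙ))` of the tensor product of the first `n` matrix algebras: the
algebra generated by all `ρ₀(a₀) ⊗ ⋯ ⊗ ρₙ₋₁(aₙ₋₁) ⊗ 1`. -/
def tensorStage (n : ℕ) : Subalgebra ℂ (LpOp p (Measure.infinitePi μ)) :=
  Algebra.adjoin ℂ
    {S | ∃ a : ∀ i, MatLp p (d i), IsTensorOp (Finset.range n) (fun i => ρ i (a i)) S}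

/-- The algebra `A(d, ρ)`: the norm closure of the increasing union of the images of the finite
tensor products of the matrix algebras. -/
def tensorUHF : Subalgebra ℂ (LpOp p (Measure.infinitePi μ)) :=
  (⨆ n, tensorStage ρ n).topologicalClosure

end Tensor

/-- A unital subalgebra `A` of `L(L^p(X, μ))` is a spatial `L^p` UHF algebra if it is
isometrically isomorphic to some `A(d, ρ)` with all `d n ≥ 2` and all `ρ n` spatial
representations on `L^p` of probability spaces. -/
def IsSpatialLpUHF {p : ℝ≥0∞} [Fact (1 ≤ p)] {X : Type u} [MeasurableSpace X] {μ : Measure X}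
    (A : Subalgebra ℂ (LpOp p μ)) : Prop :=
  ∃ (d : ℕ → ℕ) (Y : ℕ → Type v) (_ : ∀ n, MeasurableSpace (Y n)) (ν : ∀ n, Measure (Y n))
    (_ : ∀ n, IsProbabilityMeasure (ν n)) (ρ : ∀ n, MatLp p (d n) →ₐ[ℂ] LpOp p (ν n)),
    (∀ n, 2 ≤ d n) ∧ (∀ n, IsSpatialRep (ρ n)) ∧ ∃ e : A ≃ₐ[ℂ] tensorUHF ρ, Isometry e

end

/-! A finite group `K` of contractive units in a unital Banach algebra gives the diagonal `|K|⁻¹ ∑ g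
⊗ g⁻¹`. Its projective norm is at most `1`, its product is `1`, and reindexing the sum shows that it
commutes with the linear span of `K`. An increasing sequence of such groups whose spans have dense
union therefore yields an approximate diagonal bounded by `1`
(`isCAmenable_one_of_finite_subgroups`). The same averages applied to a derivation are bounded
functionals, and a weak-* limit of them implements the derivation up to a correction for the unit
(`isAmenable_of_finite_subgroups`).

A spatial UHF algebra contains such groups. The signed permutation matrices form a finite group of
contractions spanning `M_d^p` (`span_signedPermGroup`), and spatial representations keep them
contractive. An operator on one tensor factor extends to the infinite product without increase of
norm: by Fubini the `p`-th power of the norm is the integral over slices in that coordinate, and the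
operator acts slicewise (`norm_tensorSum_formalAmplify_le`). Amplifications at different coordinates
commute, so the first `n` groups generate a finite group. Since elementary tensors are total for `p
< ∞`, every generator of the `n`-th stage is a product of such amplifications
(`tensorUHF.tensorStage_le`), hence lies in the span of that group. -/

noncomputable section

/-! ## Averaging over finite groups of contractions -/

section Averaging

variable {A : Type u} [NormedRing A] [NormedAlgebra ℂ A]

namespace AlgTensor

theorem norm_tmul_le (a b : A) : ‖tmul a b‖ ≤ ‖a‖ * ‖b‖ :=
  csInf_le (costs_bddBelow _) ⟨1, fun _ => a, fun _ => b, by simp, by simp⟩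

theorem actL_tmul (a b c : A) : actL a (tmul b c) = tmul (a * b) c := rfl

theorem actR_tmul (a b c : A) : actR a (tmul b c) = tmul b (c * a) := rfl

theorem prodMap_tmul (a b : A) : prodMap (tmul a b) = a * b := LinearMap.mul'_apply

/-- The projective norm is an infimum, so an estimate for each finite representation passes to the
norm. Every bound for a map on `A ⊗ A` is obtained this way. -/
theorem le_mul_norm_of_costs {t : AlgTensor A} {C r : ℝ} (hC : 0 ≤ C)
    (h : ∀ q ∈ costs t, r ≤ C * q) : r ≤ C * ‖t‖ := by
  refine le_of_forall_pos_le_add fun ε hε => ?_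
  -- The margin is `ε / (C + 1)` because `C` may be zero.
  obtain ⟨q, hq, hq'⟩ := exists_lt_of_csInf_lt (costs_nonempty t)
    (lt_add_of_pos_right (sInf (costs t)) (div_pos hε (by positivity : 0 < C + 1)))
  have h1 : C * q ≤ C * (‖t‖ + ε / (C + 1)) := mul_le_mul_of_nonneg_left hq'.le hC
  have h2 : C * (ε / (C + 1)) ≤ ε := by
    rw [← mul_div_assoc, div_le_iff₀ (by positivity)]
    nlinarith
  linarith [h q hq]

theorem norm_actL_le (a : A) (t : AlgTensor A) : ‖actL a t‖ ≤ ‖a‖ * ‖t‖ := by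
  refine le_mul_norm_of_costs (norm_nonneg a) ?_
  rintro _ ⟨n, b, c, rfl, rfl⟩
  rw [map_sum, Finset.mul_sum]
  refine (norm_sum_le _ _).trans (Finset.sum_le_sum fun i _ => ?_)
  rw [actL_tmul]
  refine (norm_tmul_le _ _).trans ?_
  rw [← mul_assoc]
  gcongr
  exact norm_mul_le _ _

theorem norm_actR_le (a : A) (t : AlgTensor A) : ‖actR a t‖ ≤ ‖a‖ * ‖t‖ := by
  refine le_mul_norm_of_costs (norm_nonneg a) ?_
  rintro _ ⟨n, b, c, rfl, rfl⟩
  rw [map_sum, Finset.mul_sum]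
  refine (norm_sum_le _ _).trans (Finset.sum_le_sum fun i _ => ?_)
  rw [actR_tmul]
  refine (norm_tmul_le _ _).trans ?_
  rw [mul_left_comm, mul_comm ‖a‖]
  gcongr
  exact norm_mul_le _ _

theorem norm_prodMap_le (t : AlgTensor A) : ‖prodMap t‖ ≤ 1 * ‖t‖ := by
  refine le_mul_norm_of_costs zero_le_one ?_
  rintro _ ⟨n, b, c, rfl, rfl⟩
  rw [map_sum, one_mul]
  refine (norm_sum_le _ _).trans (Finset.sum_le_sum fun i _ => ?_)
  rw [prodMap_tmul]
  exact norm_mul_le _ _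

theorem actL_add (a b : A) (t : AlgTensor A) : actL (a + b) t = actL a t + actL b t := by
  have : LinearMap.mulLeft ℂ (a + b) = LinearMap.mulLeft ℂ a + LinearMap.mulLeft ℂ b := by
    ext; simp [add_mul]
  exact (congrArg (fun f => TensorProduct.map f LinearMap.id t) this).trans
    (LinearMap.congr_fun (TensorProduct.map_add_left _ _ _) t)

theorem actR_add (a b : A) (t : AlgTensor A) : actR (a + b) t = actR a t + actR b t := by
  have : LinearMap.mulRight ℂ (a + b) = LinearMap.mulRight ℂ a + LinearMap.mulRight ℂ b := by
    ext; simp [mul_add]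
  exact (congrArg (fun f => TensorProduct.map LinearMap.id f t) this).trans
    (LinearMap.congr_fun (TensorProduct.map_add_right _ _ _) t)

theorem actL_smul (c : ℂ) (a : A) (t : AlgTensor A) : actL (c • a) t = c • actL a t := by
  have : LinearMap.mulLeft ℂ (c • a) = c • LinearMap.mulLeft ℂ a := by
    ext; simp
  exact (congrArg (fun f => TensorProduct.map f LinearMap.id t) this).trans
    (LinearMap.congr_fun (TensorProduct.map_smul_left c _ _) t)

theorem actR_smul (c : ℂ) (a : A) (t : AlgTensor A) : actR (c • a) t = c • actR a t := by
  have : LinearMap.mulRight ℂ (c • a) = c • LinearMap.mulRight ℂ a := by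
    ext; simp
  exact (congrArg (fun f => TensorProduct.map LinearMap.id f t) this).trans
    (LinearMap.congr_fun (TensorProduct.map_smul_right c _ _) t)

/-- The diagonal `|K|⁻¹ ∑ g ⊗ g⁻¹` of a finite group `K` of units. -/
def groupDiagonal (K : Subgroup Aˣ) [Fintype K] : AlgTensor A :=
  ∑ g : K, tmul ((Fintype.card K : ℂ)⁻¹ • ((g : Aˣ) : A)) ((g⁻¹ : K) : Aˣ)

variable (K : Subgroup Aˣ) [Fintype K]

theorem norm_groupDiagonal_le (hK : ∀ g ∈ K, ‖(g : A)‖ ≤ 1) : ‖groupDiagonal K‖ ≤ 1 := by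
  have hc : (Fintype.card K : ℝ) ≠ 0 := Nat.cast_ne_zero.2 Fintype.card_ne_zero
  calc ‖groupDiagonal K‖ ≤ ∑ g : K, (Fintype.card K : ℝ)⁻¹ := by
        refine (norm_sum_le _ _).trans (Finset.sum_le_sum fun g _ => ?_)
        refine (norm_tmul_le _ _).trans ?_
        rw [norm_smul, norm_inv, Complex.norm_natCast, mul_assoc]
        refine mul_le_of_le_one_right (by positivity) ?_
        exact mul_le_one₀ (hK _ g.2) (norm_nonneg _) (hK _ (g⁻¹).2)
    _ = 1 := by simp [hc]

theorem prodMap_groupDiagonal : prodMap (groupDiagonal K) = 1 := by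
  have hc : (Fintype.card K : ℂ) ≠ 0 := Nat.cast_ne_zero.2 Fintype.card_ne_zero
  simp only [groupDiagonal, map_sum, prodMap_tmul, smul_mul_assoc, ← Units.val_mul,
    ← Subgroup.coe_mul, mul_inv_cancel]
  simp [← Nat.cast_smul_eq_nsmul ℂ, hc]

/-- For `h ∈ K`, the substitution `g ↦ hg` turns `∑ hg ⊗ g⁻¹` into `∑ g ⊗ g⁻¹h`. Both actions are
linear in `a`, which gives the whole span. -/
theorem actL_groupDiagonal {a : A} (ha : a ∈ Submodule.span ℂ (Units.val '' (K : Set Aˣ))) :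
    actL a (groupDiagonal K) = actR a (groupDiagonal K) := by
  induction ha using Submodule.span_induction with
  | mem x hx =>
    obtain ⟨h, hh, rfl⟩ := hx
    simp only [groupDiagonal, map_sum, actL_tmul, actR_tmul]
    refine Fintype.sum_equiv (Equiv.mulLeft ⟨h, hh⟩) _ _ fun g => ?_
    simp [mul_assoc]
  | zero =>
    have h1 := actL_smul (0 : ℂ) (0 : A) (groupDiagonal K)
    have h2 := actR_smul (0 : ℂ) (0 : A) (groupDiagonal K)
    rw [zero_smul, zero_smul] at h1 h2
    rw [h1, h2]
  | add x y _ _ hx hy => rw [actL_add, actR_add, hx, hy]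
  | smul c x _ hx => rw [actL_smul, actR_smul, hx]

end AlgTensor

namespace ProjTensor

theorem actL_coe (a : A) (t : AlgTensor A) :
    actL a (t : ProjTensor A) = (AlgTensor.actL a t : ProjTensor A) :=
  UniformSpace.Completion.map_coe
    (AddMonoidHomClass.uniformContinuous_of_bound _ _ (AlgTensor.norm_actL_le a)) t

theorem actR_coe (a : A) (t : AlgTensor A) :
    actR a (t : ProjTensor A) = (AlgTensor.actR a t : ProjTensor A) :=
  UniformSpace.Completion.map_coe
    (AddMonoidHomClass.uniformContinuous_of_bound _ _ (AlgTensor.norm_actR_le a)) t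

theorem prodMap_coe (t : AlgTensor A) :
    prodMap (t : ProjTensor A) = AlgTensor.prodMap t :=
  UniformSpace.Completion.extension_coe
    (AddMonoidHomClass.uniformContinuous_of_bound _ _ AlgTensor.norm_prodMap_le) t

end ProjTensor

/-- If `b` lies in the span of `K n`, the diagonals from stage `n` on commute with `b` exactly. For
general `a`, the commutator is then at most `2‖a - b‖`. -/
theorem isCAmenable_one_of_finite_subgroups (K : ℕ → Subgroup Aˣ) [∀ n, Finite (K n)]
    (hmono : Monotone K) (hK : ∀ n, ∀ g ∈ K n, ‖(g : A)‖ ≤ 1)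
    (hdense : Dense (⋃ n, (Submodule.span ℂ (Units.val '' (K n : Set Aˣ)) : Set A))) :
    IsCAmenable 1 A := by
  have := fun n => Fintype.ofFinite (K n)
  let m : ℕ → AlgTensor A := fun n => AlgTensor.groupDiagonal (K n)
  have hm : ∀ n, ‖m n‖ ≤ 1 := fun n => AlgTensor.norm_groupDiagonal_le _ (hK n)
  refine ⟨ULift ℕ, inferInstance, inferInstance, inferInstance, fun i => (m i.down : ProjTensor A),
    fun i => ?_, fun a => ?_, fun a => ?_⟩
  · rw [UniformSpace.Completion.norm_coe]
    exact hm _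
  · rw [Metric.tendsto_atTop]
    intro ε hε
    obtain ⟨b, hb, hab⟩ := Metric.dense_iff.1 hdense a (ε / 2) (half_pos hε)
    obtain ⟨n, hn⟩ := Set.mem_iUnion.1 hab
    refine ⟨⟨n⟩, fun i hi => ?_⟩
    have hbi : b ∈ Submodule.span ℂ (Units.val '' (K i.down : Set Aˣ)) :=
      Submodule.span_mono (Set.image_mono (hmono hi)) hn
    have h0 := AlgTensor.actL_groupDiagonal _ hbi
    have hL : AlgTensor.actL a (m i.down) =
        AlgTensor.actL (a - b) (m i.down) + AlgTensor.actL b (m i.down) := by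
      rw [← AlgTensor.actL_add, sub_add_cancel]
    have hR : AlgTensor.actR a (m i.down) =
        AlgTensor.actR (a - b) (m i.down) + AlgTensor.actR b (m i.down) := by
      rw [← AlgTensor.actR_add, sub_add_cancel]
    rw [dist_zero_right, ProjTensor.actL_coe, ProjTensor.actR_coe,
      ← UniformSpace.Completion.coe_sub, UniformSpace.Completion.norm_coe, hL, hR, h0,
      add_sub_add_right_eq_sub]
    have hlt : ‖a - b‖ < ε / 2 := by rwa [← dist_eq_norm, dist_comm]
    have h1 := AlgTensor.norm_actL_le (a - b) (m i.down)
    have h2 := AlgTensor.norm_actR_le (a - b) (m i.down)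
    have h3 := mul_le_of_le_one_right (norm_nonneg (a - b)) (hm i.down)
    have h4 := norm_sub_le (AlgTensor.actL (a - b) (m i.down)) (AlgTensor.actR (a - b) (m i.down))
    linarith
  · simp only [ProjTensor.prodMap_coe]
    simp only [m, AlgTensor.prodMap_groupDiagonal, mul_one]
    exact tendsto_const_nhds

/-! ### Derivations into dual bimodules -/

namespace BanachBimodule

variable {E : Type w} [NormedAddCommGroup E] [NormedSpace ℂ E]

/-- The average `|K|⁻¹ ∑ g · D(g⁻¹)` over a finite group `K` of units. -/
def average (M : BanachBimodule A E) (D : A →L[ℂ] StrongDual ℂ E) (K : Subgroup Aˣ)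
    [Fintype K] : StrongDual ℂ E :=
  (Fintype.card K : ℂ)⁻¹ • ∑ g : K, M.dualL ((g : Aˣ) : A) (D ((g⁻¹ : K) : Aˣ))

variable (M : BanachBimodule A E) (D : A →L[ℂ] StrongDual ℂ E) (K : Subgroup Aˣ) [Fintype K]

theorem norm_average_le (hK : ∀ g ∈ K, ‖(g : A)‖ ≤ 1) : ‖M.average D K‖ ≤ ‖D‖ * ‖M.ract‖ := by
  have hc : (Fintype.card K : ℝ) ≠ 0 := Nat.cast_ne_zero.2 Fintype.card_ne_zero
  rw [average, norm_smul, norm_inv, Complex.norm_natCast]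
  have : ‖∑ g : K, M.dualL ((g : Aˣ) : A) (D ((g⁻¹ : K) : Aˣ))‖ ≤
      ∑ g : K, ‖D‖ * ‖M.ract‖ := by
    refine (norm_sum_le _ _).trans (Finset.sum_le_sum fun g _ => ?_)
    refine (ContinuousLinearMap.opNorm_comp_le _ _).trans ?_
    gcongr
    · exact (D.le_opNorm _).trans (mul_le_of_le_one_right (norm_nonneg _) (hK _ (g⁻¹).2))
    · exact (M.ract.le_opNorm _).trans (mul_le_of_le_one_right (norm_nonneg _) (hK _ g.2))
  calc _ ≤ (Fintype.card K : ℝ)⁻¹ * ∑ g : K, ‖D‖ * ‖M.ract‖ := by gcongr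
    _ = _ := by simp [hc]

/-- For `h ∈ K`, write `g⁻¹ = (hg)⁻¹h`, apply the Leibniz rule and sum over `hg` instead of `g`. One
term of the rule rebuilds the average; in the other, `hg` cancels and leaves `D h`. The right action
of `1` survives because the unit need not act as the identity. -/
theorem average_commutator
    (hD : ∀ a b : A, D (a * b) = M.dualL a (D b) + M.dualR b (D a))
    {a : A} (ha : a ∈ Submodule.span ℂ (Units.val '' (K : Set Aˣ))) (x : E) :
    M.average D K (M.ract a x) - M.average D K (M.lact a x) = D a (M.ract 1 x) := by
  have hc : (Fintype.card K : ℂ) ≠ 0 := Nat.cast_ne_zero.2 Fintype.card_ne_zero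
  induction ha using Submodule.span_induction with
  | mem y hy =>
    obtain ⟨h, hh, rfl⟩ := hy
    have hD' : ∀ a b : A, ∀ x, D (a * b) x = D b (M.ract a x) + D a (M.lact b x) :=
      fun a b x => by rw [hD]; rfl
    have key : ∑ g : K, D ((g⁻¹ : K) : Aˣ) (M.ract ((g : Aˣ) : A) (M.ract (h : A) x)) =
        ∑ g : K, (D (h : A) (M.ract 1 x) +
          D ((g⁻¹ : K) : Aˣ) (M.ract ((g : Aˣ) : A) (M.lact (h : A) x))) := by
      refine Fintype.sum_equiv (Equiv.mulLeft ⟨h, hh⟩) _ _ fun g => ?_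
      have h1 : (((g⁻¹ : K) : Aˣ) : A) =
          ((((⟨h, hh⟩ * g)⁻¹ : K) : Aˣ) : A) * (h : A) := by
        simp [mul_assoc]
      rw [← M.ract_mul, h1, hD', ← M.ract_mul, M.lact_ract]
      simp [mul_assoc]
    simp only [average, smul_apply, sum_apply, dualL,
      ContinuousLinearMap.comp_apply]
    rw [key, Finset.sum_add_distrib, smul_add, add_sub_cancel_right]
    simp [hc]
  | zero => simp
  | add y z _ _ hy hz =>
    simp only [map_add, add_apply, ← hy, ← hz]
    ring
  | smul c y _ hy =>
    simp only [map_smul, smul_apply, ← hy, smul_sub]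

end BanachBimodule

theorem isAmenable_of_finite_subgroups (K : ℕ → Subgroup Aˣ) [∀ n, Finite (K n)]
    (hmono : Monotone K) (hK : ∀ n, ∀ g ∈ K n, ‖(g : A)‖ ≤ 1)
    (hdense : Dense (⋃ n, (Submodule.span ℂ (Units.val '' (K n : Set Aˣ)) : Set A))) :
    IsAmenable.{u, w} A := by
  have := fun n => Fintype.ofFinite (K n)
  intro E _ _ _ M D hD
  let s : ℕ → WeakDual ℂ E := fun n => StrongDual.toWeakDual (M.average D (K n))
  -- Banach–Alaoglu: the averages stay in a fixed ball, so they converge weak-* along a free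
  -- ultrafilter.
  obtain ⟨φ, -, hφ⟩ := (WeakDual.isCompact_closedBall (𝕜 := ℂ) (E := E) 0
    (‖D‖ * ‖M.ract‖)).ultrafilter_le_nhds' ((Filter.hyperfilter ℕ).map s) (by
      refine Filter.mem_map.2 (Filter.univ_mem' fun n => ?_)
      simpa [s] using M.norm_average_le D (K n) (hK n))
  have hlim : ∀ x, Filter.Tendsto (fun n => M.average D (K n) x) (Filter.hyperfilter ℕ)
      (𝓝 (φ x)) := fun x => ((WeakDual.eval_continuous x).tendsto φ).comp hφ
  let φ' : StrongDual ℂ E := WeakDual.toStrongDual φ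
  have hcomm : ∀ a x, φ' (M.ract a x) - φ' (M.lact a x) = D a (M.ract 1 x) := by
    intro a x
    refine hdense.induction (P := fun a => φ' (M.ract a x) - φ' (M.lact a x) = D a (M.ract 1 x))
      ?_ ?_ a
    · intro b hb
      obtain ⟨n, hn⟩ := Set.mem_iUnion.1 hb
      refine tendsto_nhds_unique ((hlim (M.ract b x)).sub (hlim (M.lact b x))) ?_
      refine tendsto_const_nhds.congr' ?_
      -- The commutator identity for `b` holds at all stages `m ≥ n`, hence along the free
      -- ultrafilter.
      refine Filter.Eventually.filter_mono
        ((Filter.hyperfilter_le_cofinite).trans Nat.cofinite_eq_atTop.le) ?_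
      filter_upwards [Filter.eventually_ge_atTop n] with m hm
      exact (M.average_commutator D (K m) hD
        (Submodule.span_mono (Set.image_mono (hmono hm)) hn) x).symm
    · exact isClosed_eq (by fun_prop) (by fun_prop)
  have hD' : ∀ a b : A, ∀ x, D (a * b) x = D b (M.ract a x) + D a (M.lact b x) :=
    fun a b x => by rw [hD]; rfl
  -- The limit only gives `a · φ' - φ' · a = 1 · D a`, whereas `D a = 1 · D a + D 1 · a`. The
  -- Leibniz rule at `1 = 1 * 1` forces `1 · D 1 · 1 = 0`, so the commutator of `a` with `-(D 1 ·
  -- 1)` is the missing `D 1 · a`.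
  refine ⟨φ' - M.dualR 1 (D 1), fun a => ?_⟩
  ext x
  have h1 := hD' 1 a x
  have h2 := hD' 1 1 (M.lact 1 (M.ract a x))
  have h3 := hcomm a x
  rw [← M.lact_ract, ← M.ract_mul, ← M.lact_mul, mul_one, mul_one] at h2
  have h4 : M.lact 1 (M.lact a x) = M.lact a x := by rw [← M.lact_mul, one_mul]
  simp only [one_mul] at h1
  simp only [BanachBimodule.dualL, BanachBimodule.dualR, ContinuousLinearMap.comp_apply,
    sub_apply, h4]
  linear_combination h1 - h3 - h2
end Averaging

/-! ## Amplification of operators to infinite tensor products -/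

/-- A π-λ argument: the sets with indicator in `V` are closed under complements by subtraction from
the constant `1`, and under countable disjoint unions because `V` is closed and `p < ∞`. Indicators
of all measurable sets then span a dense subspace. -/
theorem MeasureTheory.Lp.submodule_eq_top_of_isPiSystem {α : Type*} {m : MeasurableSpace α}
    {μ : Measure α} [IsFiniteMeasure μ] {p : ℝ≥0∞} [Fact (1 ≤ p)] (hp : p ≠ ∞) {C : Set (Set α)}
    (hgen : m = MeasurableSpace.generateFrom C) (hC : IsPiSystem C)
    (V : Submodule ℂ (Lp ℂ p μ)) (hV : IsClosed (V : Set (Lp ℂ p μ)))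
    (huniv : indicatorConstLp p .univ (measure_ne_top μ _) (1 : ℂ) ∈ V)
    (hmem : ∀ s ∈ C, ∀ hs : MeasurableSet s,
      indicatorConstLp p hs (measure_ne_top μ s) (1 : ℂ) ∈ V) : V = ⊤ := by
  have hcongr : ∀ {s t : Set α} (hs : MeasurableSet s) (ht : MeasurableSet t), s = t →
      indicatorConstLp p hs (measure_ne_top μ s) (1 : ℂ) =
        indicatorConstLp p ht (measure_ne_top μ t) (1 : ℂ) := by
    rintro s _ hs ht rfl
    rfl
  have hunion : ∀ {s t : Set α} (hs : MeasurableSet s) (ht : MeasurableSet t), Disjoint s t →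
      indicatorConstLp p (hs.union ht) (measure_ne_top μ _) (1 : ℂ) =
        indicatorConstLp p hs (measure_ne_top μ s) (1 : ℂ) +
          indicatorConstLp p ht (measure_ne_top μ t) (1 : ℂ) := fun hs ht h =>
    indicatorConstLp_disjoint_union hs ht (measure_ne_top μ _) (measure_ne_top μ _) h 1
  have hempty : indicatorConstLp p .empty (measure_ne_top μ ∅) (1 : ℂ) ∈ V := by
    rw [show indicatorConstLp p .empty (measure_ne_top μ ∅) (1 : ℂ) = 0 from
      indicatorConstLp_empty]
    exact V.zero_mem
  have hind : ∀ s (hs : MeasurableSet s),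
      indicatorConstLp p hs (measure_ne_top μ s) (1 : ℂ) ∈ V := by
    refine MeasurableSpace.induction_on_inter
      (C := fun s hs => indicatorConstLp p hs (measure_ne_top μ s) (1 : ℂ) ∈ V) hgen hC hempty
      (fun s hs => hmem s hs _) ?_ ?_
    · intro t ht hVt
      have h := hunion ht ht.compl disjoint_compl_right
      rw [hcongr (ht.union ht.compl) .univ (Set.union_compl_self t)] at h
      rw [← sub_eq_iff_eq_add'.2 h]
      exact V.sub_mem huniv hVt
    · intro f hf hfm hVf
      let U : ℕ → Set α := fun n => ⋃ i ∈ Finset.range n, f i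
      have hUm : ∀ n, MeasurableSet (U n) := fun n => Finset.measurableSet_biUnion _ fun i _ => hfm i
      have hUV : ∀ n, indicatorConstLp p (hUm n) (measure_ne_top μ _) (1 : ℂ) ∈ V := by
        intro n
        induction n with
        | zero => rwa [hcongr (hUm 0) .empty (by simp [U])]
        | succ n ih =>
          have hdis : Disjoint (f n) (U n) := by
            simp only [U, Set.disjoint_iUnion_right, Finset.mem_range]
            exact fun i hi => hf hi.ne'
          rw [hcongr (hUm (n + 1)) ((hfm n).union (hUm n))
            (by simp only [U, Finset.range_add_one, Finset.set_biUnion_insert]), hunion (hfm n) (hUm n) hdis]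
          exact V.add_mem (hVf n) ih
      refine hV.mem_of_tendsto (tendsto_indicatorConstLp_set (t := U) (ht := hUm)
        (hμt := fun n => measure_ne_top μ _) (l := Filter.atTop) hp ?_)
        (Filter.Eventually.of_forall hUV)
      have hsub : ∀ n, U n ⊆ ⋃ i, f i := fun n => Set.iUnion₂_subset fun i _ =>
        Set.subset_iUnion f i
      have hmono : Monotone U := fun a b hab => Set.biUnion_subset_biUnion_left
        (Finset.coe_subset.2 (Finset.range_mono hab))
      -- The remainders of the union decrease to `∅`, so their finite measures tend to `0`; this is
      -- convergence of the indicators in `L^p`.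
      have h := tendsto_measure_iInter_atTop (μ := μ) (s := fun n => (⋃ i, f i) \ U n)
        (fun n => ((MeasurableSet.iUnion hfm).diff (hUm n)).nullMeasurableSet)
        (fun a b hab => Set.sdiff_subset_sdiff_right (hmono hab)) ⟨0, measure_ne_top μ _⟩
      have hinter : ⋂ n, (⋃ i, f i) \ U n = ∅ := by
        refine Set.eq_empty_of_forall_notMem fun x hx => ?_
        rw [Set.mem_iInter] at hx
        obtain ⟨i, hi⟩ := Set.mem_iUnion.1 (hx 0).1
        exact (hx (i + 1)).2 (Set.mem_biUnion (Finset.mem_coe.2 (Finset.self_mem_range_succ i)) hi)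
      rw [hinter, measure_empty] at h
      refine h.congr fun n => ?_
      rw [Set.symmDiff_def, Set.sdiff_eq_empty.2 (hsub n)]
      simp
  refine eq_top_iff.2 fun f _ => ?_
  refine Lp.induction hp (fun f => f ∈ V) (fun c s hs hμs => ?_)
    (fun f g hf hg _ h1 h2 => V.add_mem h1 h2) hV f
  rw [Lp.simpleFunc.coe_indicatorConst]
  have : indicatorConstLp p hs hμs.ne c =
      c • indicatorConstLp p hs (measure_ne_top μ s) (1 : ℂ) := by
    refine Lp.ext ?_
    filter_upwards [indicatorConstLp_coeFn (p := p) (hs := hs) (hμs := hμs.ne) (c := c),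
      Lp.coeFn_smul c (indicatorConstLp p hs (measure_ne_top μ s) (1 : ℂ)),
      indicatorConstLp_coeFn (p := p) (hs := hs) (hμs := measure_ne_top μ s) (c := (1 : ℂ))]
      with x h1 h2 h3
    rw [h1, h2, Pi.smul_apply, h3]
    by_cases hx : x ∈ s <;> simp [hx]
  rw [this]
  exact V.smul_mem c (hind s hs)

section Amplification

variable {p : ℝ≥0∞} [Fact (1 ≤ p)] {X : ℕ → Type v} [∀ n, MeasurableSpace (X n)]
  {μ : ∀ n, Measure (X n)} [∀ n, IsProbabilityMeasure (μ n)]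

/-- Resampling one coordinate independently does not change the product law: on a box, the factor at
`i` moves to the new variable and the old coordinate becomes free, with mass one. This permits
Fubini in the coordinate `i` without splitting the infinite product. -/
theorem measurePreserving_update_infinitePi (i : ℕ) :
    MeasurePreserving (fun z : X i × (∀ n, X n) => Function.update z.2 i z.1)
      ((μ i).prod (Measure.infinitePi μ)) (Measure.infinitePi μ) := by
  have hm : Measurable (fun z : X i × (∀ n, X n) => Function.update z.2 i z.1) := by
    refine measurable_pi_iff.2 fun j => ?_
    by_cases h : j = i
    · subst h
      simpa using measurable_fst
    · simp only [Function.update_of_ne h]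
      fun_prop
  refine ⟨hm, Measure.eq_infinitePi μ fun s t ht => ?_⟩
  rw [Measure.map_apply hm (MeasurableSet.pi s.countable_toSet fun j _ => ht j)]
  by_cases hi : i ∈ s
  · have : (fun z : X i × (∀ n, X n) => Function.update z.2 i z.1) ⁻¹' Set.pi s t =
        t i ×ˢ Set.pi (s.erase i) t := by
      ext z
      simp only [Set.mem_preimage, Set.mem_pi, Set.mem_prod, Finset.mem_coe, Finset.mem_erase]
      constructor
      · intro h
        refine ⟨by simpa using h i hi, fun j hj => by simpa [hj.1] using h j hj.2⟩
      · rintro ⟨h1, h2⟩ j hj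
        by_cases hji : j = i
        · subst hji
          simpa using h1
        · simpa [hji] using h2 j ⟨hji, hj⟩
    rw [this, Measure.prod_prod, Measure.infinitePi_pi μ (mt := fun j _ => ht j),
      Finset.mul_prod_erase s (fun j => μ j (t j)) hi]
  · have : (fun z : X i × (∀ n, X n) => Function.update z.2 i z.1) ⁻¹' Set.pi s t =
        Set.univ ×ˢ Set.pi s t := by
      ext z
      simp only [Set.mem_preimage, Set.mem_pi, Set.mem_prod, Finset.mem_coe, Set.mem_univ,
        true_and]
      refine forall₂_congr fun j hj => ?_
      rw [Function.update_of_ne (ne_of_mem_of_not_mem hj hi)]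
    rw [this, Measure.prod_prod, Measure.infinitePi_pi μ (mt := fun j _ => ht j), measure_univ,
      one_mul]

/-- Coordinate projections preserve measure, so null sets in the factors pull back to null sets. Any
representatives of the factors may therefore be used. -/
theorem coeFn_elemTensor_of_ae {G : Finset ℕ} {ξ : ∀ n, Lp ℂ p (μ n)} {g : ∀ n, X n → ℂ}
    (h : ∀ n ∈ G, ξ n =ᵐ[μ n] g n) :
    elemTensor G ξ =ᵐ[Measure.infinitePi μ] fun x => ∏ i ∈ G, g i (x i) := by
  have h' : ∀ᵐ x ∂(Measure.infinitePi μ), ∀ n ∈ G, ξ n (x n) = g n (x n) :=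
    (ae_ball_iff G.countable_toSet).2 fun n hn =>
      (measurePreserving_eval_infinitePi μ n).quasiMeasurePreserving.ae (h n hn)
  filter_upwards [(memLp_elemTensor G ξ).coeFn_toLp, h'] with x h1 h2
  rw [elemTensor, h1]
  exact Finset.prod_congr rfl fun n hn => h2 n hn

theorem elemTensor_congr {G : Finset ℕ} {ξ η : ∀ n, Lp ℂ p (μ n)} (h : ∀ n ∈ G, ξ n = η n) :
    elemTensor G ξ = elemTensor G η :=
  Lp.ext ((coeFn_elemTensor_of_ae fun n hn => by rw [h n hn]).trans
    (coeFn_elemTensor_of_ae fun n _ => ae_eq_rfl).symm)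

theorem elemTensor_update_add {G : Finset ℕ} {i : ℕ} (hi : i ∈ G) (ξ : ∀ n, Lp ℂ p (μ n))
    (a b : Lp ℂ p (μ i)) :
    elemTensor G (Function.update ξ i (a + b)) =
      elemTensor G (Function.update ξ i a) + elemTensor G (Function.update ξ i b) := by
  refine Lp.ext ?_
  have h := coeFn_elemTensor_of_ae (G := G) (ξ := Function.update ξ i (a + b))
    (g := Function.update (fun n => (ξ n : X n → ℂ)) i (a + b)) (fun n _ => by
      by_cases hn : n = i
      · subst hn
        simpa using Lp.coeFn_add a b
      · simp [hn])
  have hs : ∀ c : Lp ℂ p (μ i), _ := fun c =>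
    coeFn_elemTensor_of_ae (G := G) (ξ := Function.update ξ i c)
    (g := Function.update (fun n => (ξ n : X n → ℂ)) i c) (fun n _ => by
      by_cases hn : n = i
      · subst hn
        simp
      · simp [hn])
  filter_upwards [h, hs a, hs b, Lp.coeFn_add (elemTensor G (Function.update ξ i a))
    (elemTensor G (Function.update ξ i b))] with x h1 h2 h3 h4
  rw [h1, h4, Pi.add_apply, h2, h3]
  simp only [← Finset.mul_prod_erase G _ hi, Function.update_self, Pi.add_apply, add_mul]
  congr 1 <;> congr 1 <;> refine Finset.prod_congr rfl fun j hj => ?_ <;>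
    simp [Finset.ne_of_mem_erase hj]

theorem elemTensor_update_smul {G : Finset ℕ} {i : ℕ} (hi : i ∈ G) (ξ : ∀ n, Lp ℂ p (μ n))
    (c : ℂ) (a : Lp ℂ p (μ i)) :
    elemTensor G (Function.update ξ i (c • a)) = c • elemTensor G (Function.update ξ i a) := by
  refine Lp.ext ?_
  have h := coeFn_elemTensor_of_ae (G := G) (ξ := Function.update ξ i (c • a))
    (g := Function.update (fun n => (ξ n : X n → ℂ)) i (c • ⇑a)) (fun n _ => by
      by_cases hn : n = i
      · subst hn
        simpa using Lp.coeFn_smul c a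
      · simp [hn])
  have hs := coeFn_elemTensor_of_ae (G := G) (ξ := Function.update ξ i a)
    (g := Function.update (fun n => (ξ n : X n → ℂ)) i a) (fun n _ => by
      by_cases hn : n = i
      · subst hn
        simp
      · simp [hn])
  filter_upwards [h, hs, Lp.coeFn_smul c (elemTensor G (Function.update ξ i a))] with x h1 h2 h3
  rw [h1, h3, Pi.smul_apply, h2]
  simp only [← Finset.mul_prod_erase G _ hi, Function.update_self, Pi.smul_apply, smul_eq_mul,
    mul_assoc]
  congr 2
  refine Finset.prod_congr rfl fun j hj => ?_
  simp [Finset.ne_of_mem_erase hj]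

/-- Indicators of measurable boxes are elementary tensors, and boxes form a generating π-system.
Demanding `F ⊆ G` costs nothing, since extra coordinates can carry the factor `1`. -/
theorem dense_span_elemTensor (hp : p ≠ ∞) (F : Finset ℕ) :
    Dense (Submodule.span ℂ {f | ∃ G : Finset ℕ, F ⊆ G ∧ ∃ ξ : ∀ n, Lp ℂ p (μ n),
      elemTensor G ξ = f} : Set (Lp ℂ p (Measure.infinitePi μ))) := by
  rw [Submodule.dense_iff_topologicalClosure_eq_top]
  set V := Submodule.span ℂ {f | ∃ G : Finset ℕ, F ⊆ G ∧ ∃ ξ : ∀ n, Lp ℂ p (μ n),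
      elemTensor G ξ = f}
  have hbox : ∀ (s : Finset ℕ) (t : ∀ n, Set (X n)), (∀ n, MeasurableSet (t n)) →
      ∀ h : MeasurableSet (Set.pi (s : Set ℕ) t),
        indicatorConstLp p h (measure_ne_top (Measure.infinitePi μ) _) (1 : ℂ) ∈ V := by
    intro s t ht h
    let t' : ∀ n, Set (X n) := fun n => if n ∈ s then t n else Set.univ
    have ht' : ∀ n, MeasurableSet (t' n) := fun n => by
      by_cases hn : n ∈ s
      · simpa [t', hn] using ht n
      · simp [t', hn]
    refine Submodule.subset_span ⟨s ∪ F, Finset.subset_union_right,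
      fun n => indicatorConstLp p (ht' n) (measure_ne_top (μ n) _) 1, Lp.ext ?_⟩
    refine (coeFn_elemTensor_of_ae fun n _ => indicatorConstLp_coeFn).trans
      (Filter.EventuallyEq.trans (Filter.EventuallyEq.of_eq ?_) indicatorConstLp_coeFn.symm)
    ext x
    by_cases hx : x ∈ Set.pi (s : Set ℕ) t
    · rw [Set.indicator_of_mem hx]
      refine Finset.prod_eq_one fun n _ => Set.indicator_of_mem ?_ _
      by_cases hn : n ∈ s
      · simpa [t', hn] using hx n hn
      · simp [t', hn]
    · rw [Set.indicator_of_notMem hx]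
      simp only [Set.mem_pi, not_forall] at hx
      obtain ⟨n, hn, hxn⟩ := hx
      have hn' : n ∈ s := hn
      refine Finset.prod_eq_zero (Finset.mem_union_left F hn') (Set.indicator_of_notMem ?_ _)
      simpa [t', hn'] using hxn
  refine Lp.submodule_eq_top_of_isPiSystem hp generateFrom_squareCylinders.symm
    (isPiSystem_squareCylinders (fun n => MeasurableSpace.isPiSystem_measurableSet)
      fun n => MeasurableSet.univ) _ V.isClosed_topologicalClosure ?_ ?_
  · refine V.le_topologicalClosure ?_
    have := hbox ∅ (fun _ => Set.univ) (fun _ => .univ) (by simp)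
    convert! this
    simp
  · rintro _ ⟨s, t, ht, rfl⟩ hs
    exact V.le_topologicalClosure (hbox s t (fun n => ht n (Set.mem_univ n)) hs)

theorem LpOp.ext_elemTensor (hp : p ≠ ∞) (F : Finset ℕ) {S T : LpOp p (Measure.infinitePi μ)}
    (h : ∀ G : Finset ℕ, F ⊆ G → ∀ ξ : ∀ n, Lp ℂ p (μ n),
      S (elemTensor G ξ) = T (elemTensor G ξ)) : S = T := by
  refine ContinuousLinearMap.ext_on (dense_span_elemTensor hp F) ?_
  rintro _ ⟨G, hG, ξ, rfl⟩
  exact h G hG ξ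

end Amplification

/-! ### Slicing in one coordinate and the norm of an amplification -/

theorem MeasureTheory.Lp.enorm_rpow_eq_lintegral {α : Type*} [MeasurableSpace α] {μ : Measure α}
    {p : ℝ≥0∞} [Fact (1 ≤ p)] (hp : p ≠ ∞) (f : Lp ℂ p μ) :
    ‖f‖ₑ ^ p.toReal = ∫⁻ x, ‖f x‖ₑ ^ p.toReal ∂μ := by
  have hp0 : p ≠ 0 := (zero_lt_one.trans_le (Fact.out : 1 ≤ p)).ne'
  rw [Lp.enorm_def, eLpNorm_eq_lintegral_rpow_enorm_toReal hp0 hp, ← ENNReal.rpow_mul, one_div,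
    inv_mul_cancel₀ (ENNReal.toReal_pos hp0 hp).ne', ENNReal.rpow_one]

theorem MeasureTheory.Lp.coeFn_linearCombination {α κ : Type*} [MeasurableSpace α] {μ : Measure α}
    {p : ℝ≥0∞} {h : κ → Lp ℂ p μ} {g : κ → α → ℂ} (hg : ∀ k, h k =ᵐ[μ] g k) (v : κ →₀ ℂ) :
    Finsupp.linearCombination ℂ h v =ᵐ[μ] fun x => v.sum fun k c => c * g k x := by
  induction v using Finsupp.induction_linear with
  | zero =>
    filter_upwards [Lp.coeFn_zero ℂ p μ] with x hx
    rw [map_zero, hx]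
    simp
  | add v w hv hw =>
    filter_upwards [Lp.coeFn_add (Finsupp.linearCombination ℂ h v)
      (Finsupp.linearCombination ℂ h w), hv, hw] with x h1 h2 h3
    rw [map_add, h1, Pi.add_apply, h2, h3, Finsupp.sum_add_index' (by simp)
      (fun _ _ _ => add_mul _ _ _)]
  | single k c =>
    filter_upwards [Lp.coeFn_smul c (h k), hg k] with x h1 h2
    rw [Finsupp.linearCombination_single, h1, Pi.smul_apply, h2, Finsupp.sum_single_index (by simp),
      smul_eq_mul]

section Amplification

variable {p : ℝ≥0∞} [Fact (1 ≤ p)] {X : ℕ → Type v} [∀ n, MeasurableSpace (X n)]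
  {μ : ∀ n, Measure (X n)}

/-- The indices of elementary tensors with a factor at the coordinate `i`. -/
abbrev TensorIndex (p : ℝ≥0∞) [Fact (1 ≤ p)] (μ : ∀ n, Measure (X n)) (i : ℕ) : Type v :=
  {G : Finset ℕ // i ∈ G} × (∀ n, Lp ℂ p (μ n))

/-- The slice at `x` in the direction of the coordinate `i` of a formal linear combination of
elementary tensors, as an element of `L^p(Xᵢ, μᵢ)`. -/
def tensorSlice (i : ℕ) (v : TensorIndex p μ i →₀ ℂ) (x : ∀ n, X n) : Lp ℂ p (μ i) :=
  Finsupp.linearCombination ℂ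
    (fun k : TensorIndex p μ i => (∏ j ∈ (k.1 : Finset ℕ).erase i, k.2 j (x j)) • k.2 i) v

/-- The action of an operator at the coordinate `i` on formal linear combinations of elementary
tensors. -/
def formalAmplify (i : ℕ) (T : LpOp p (μ i)) :
    (TensorIndex p μ i →₀ ℂ) →ₗ[ℂ] (TensorIndex p μ i →₀ ℂ) :=
  Finsupp.lmapDomain ℂ ℂ fun k => (k.1, Function.update k.2 i (T (k.2 i)))

/-- The factors at the other coordinates are scalars once `x` is fixed, and `T` is linear. The
identity holds at every `x`, since the representatives of those factors are untouched. -/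
theorem tensorSlice_formalAmplify (i : ℕ) (T : LpOp p (μ i)) (v : TensorIndex p μ i →₀ ℂ)
    (x : ∀ n, X n) : tensorSlice i (formalAmplify i T v) x = T (tensorSlice i v x) := by
  rw [tensorSlice, tensorSlice, formalAmplify, Finsupp.lmapDomain_apply,
    Finsupp.linearCombination_mapDomain, ← ContinuousLinearMap.coe_coe T,
    Finsupp.apply_linearCombination]
  congr 2
  ext1 k
  simp only [Function.comp_apply, Function.update_self, ContinuousLinearMap.coe_coe, map_smul]
  congr 1
  refine Finset.prod_congr rfl fun j hj => ?_
  rw [Function.update_of_ne (Finset.ne_of_mem_erase hj)]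

variable [∀ n, IsProbabilityMeasure (μ n)]

/-- The formal linear combinations of elementary tensors, as elements of `L^p(∏ Xₙ, ∏ μₙ)`. -/
def tensorSum (p : ℝ≥0∞) [Fact (1 ≤ p)] (μ : ∀ n, Measure (X n))
    [∀ n, IsProbabilityMeasure (μ n)] (i : ℕ) :
    (TensorIndex p μ i →₀ ℂ) →ₗ[ℂ] Lp ℂ p (Measure.infinitePi μ) :=
  Finsupp.linearCombination ℂ fun k => elemTensor k.1 k.2

/-- Fubini: after resampling the coordinate `i`, the inner integral over `X i` is the `p`-th power
of the norm of the slice. -/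
theorem enorm_tensorSum_rpow (hp : p ≠ ∞) (i : ℕ) (v : TensorIndex p μ i →₀ ℂ) :
    ‖tensorSum p μ i v‖ₑ ^ p.toReal =
      ∫⁻ x, ‖tensorSlice i v x‖ₑ ^ p.toReal ∂(Measure.infinitePi μ) := by
  let Φ : (∀ n, X n) → ℂ := fun x =>
    v.sum fun k c => c * ∏ j ∈ (k.1 : Finset ℕ), k.2 j (x j)
  have hm : ∀ n (f : Lp ℂ p (μ n)), Measurable f := fun n f => (Lp.stronglyMeasurable f).measurable
  have hΦm : Measurable Φ := by
    refine Finset.measurable_fun_sum _ fun k _ => measurable_const.mul ?_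
    exact Finset.measurable_fun_prod _ fun j _ => (hm j _).comp (measurable_pi_apply j)
  have hΦ : tensorSum p μ i v =ᵐ[Measure.infinitePi μ] Φ :=
    Lp.coeFn_linearCombination (fun k => coeFn_elemTensor_of_ae fun n _ => ae_eq_rfl) v
  have hmp := measurePreserving_update_infinitePi (μ := μ) i
  have hF : Measurable fun x => ‖Φ x‖ₑ ^ p.toReal := hΦm.enorm.pow_const _
  have hFu : Measurable fun z : X i × (∀ n, X n) =>
      ‖Φ (Function.update z.2 i z.1)‖ₑ ^ p.toReal := hF.comp hmp.measurable
  rw [Lp.enorm_rpow_eq_lintegral hp,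
    lintegral_congr_ae (hΦ.mono fun x hx => congrArg (fun z => ‖z‖ₑ ^ p.toReal) hx),
    ← hmp.lintegral_comp hF, lintegral_prod_symm' _ hFu]
  refine lintegral_congr fun x => ?_
  rw [Lp.enorm_rpow_eq_lintegral hp]
  have hs : tensorSlice i v x =ᵐ[μ i] fun s => v.sum fun k c =>
      c * ((∏ j ∈ (k.1 : Finset ℕ).erase i, k.2 j (x j)) * k.2 i s) :=
    Lp.coeFn_linearCombination (fun k => Lp.coeFn_smul _ _) v
  refine lintegral_congr_ae (hs.mono fun s h => ?_)
  dsimp only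
  rw [h]
  congr 2
  refine Finset.sum_congr rfl fun k _ => ?_
  dsimp only
  rw [← Finset.mul_prod_erase _ _ k.1.2, Function.update_self, mul_comm (k.2 i s)]
  congr 2
  refine Finset.prod_congr rfl fun j hj => ?_
  rw [Function.update_of_ne (Finset.ne_of_mem_erase hj)]

/-- The bound by `‖T‖` holds on each slice and is then integrated. It also shows that the formal
action respects relations between elementary tensors, so that it descends to an operator. -/
theorem norm_tensorSum_formalAmplify_le (hp : p ≠ ∞) (i : ℕ) (T : LpOp p (μ i))
    (v : TensorIndex p μ i →₀ ℂ) :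
    ‖(tensorSum p μ i ∘ₗ formalAmplify i T) v‖ ≤ ‖T‖ * ‖tensorSum p μ i v‖ := by
  have hp0 : 0 < p.toReal :=
    ENNReal.toReal_pos (zero_lt_one.trans_le (Fact.out : 1 ≤ p)).ne' hp
  suffices h : ‖tensorSum p μ i (formalAmplify i T v)‖ₑ ≤ ‖T‖ₑ * ‖tensorSum p μ i v‖ₑ by
    simp only [enorm_eq_nnnorm] at h
    exact_mod_cast h
  rw [← ENNReal.rpow_le_rpow_iff hp0, ENNReal.mul_rpow_of_nonneg _ _ hp0.le,
    enorm_tensorSum_rpow hp, enorm_tensorSum_rpow hp,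
    ← lintegral_const_mul' _ _ (ENNReal.rpow_ne_top_of_nonneg hp0.le enorm_ne_top)]
  refine lintegral_mono fun x => ?_
  rw [tensorSlice_formalAmplify, ← ENNReal.mul_rpow_of_nonneg _ _ hp0.le]
  exact ENNReal.rpow_le_rpow (T.le_opENorm _) hp0.le

theorem denseRange_tensorSum (hp : p ≠ ∞) (i : ℕ) : DenseRange (tensorSum p μ i) := by
  refine (dense_span_elemTensor hp {i}).mono (SetLike.coe_subset_coe.2 (?_ : _ ≤
    LinearMap.range (tensorSum p μ i)))
  rw [Submodule.span_le]
  rintro _ ⟨G, hG, ξ, rfl⟩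
  exact ⟨Finsupp.single (⟨G, Finset.singleton_subset_iff.1 hG⟩, ξ) 1, by simp [tensorSum]⟩

/-- The operator on `L^p(∏ Xₙ, ∏ μₙ)` which acts as `T` on the coordinate `i` and as the identity
on the others. -/
def amplify (i : ℕ) (T : LpOp p (μ i)) : LpOp p (Measure.infinitePi μ) :=
  (tensorSum p μ i ∘ₗ formalAmplify i T).extendOfNorm (tensorSum p μ i)

theorem norm_amplify_le (hp : p ≠ ∞) (i : ℕ) (T : LpOp p (μ i)) : ‖amplify i T‖ ≤ ‖T‖ :=
  ContinuousLinearMap.opNorm_le_bound _ (norm_nonneg T) fun x =>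
    LinearMap.norm_extendOfNorm_apply_le (denseRange_tensorSum hp i) ‖T‖
      (norm_tensorSum_formalAmplify_le hp i T) x

theorem amplify_elemTensor (hp : p ≠ ∞) {i : ℕ} (T : LpOp p (μ i)) {G : Finset ℕ} (hi : i ∈ G)
    (ξ : ∀ n, Lp ℂ p (μ n)) :
    amplify i T (elemTensor G ξ) = elemTensor G (Function.update ξ i (T (ξ i))) := by
  have h := LinearMap.extendOfNorm_eq (denseRange_tensorSum hp i)
    ⟨‖T‖, norm_tensorSum_formalAmplify_le hp i T⟩ (Finsupp.single (⟨G, hi⟩, ξ) 1)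
  simpa [tensorSum, formalAmplify] using! h

theorem LpOp.ext_elemTensor_of_mem (hp : p ≠ ∞) (i : ℕ) {S T : LpOp p (Measure.infinitePi μ)}
    (h : ∀ G : Finset ℕ, i ∈ G → ∀ ξ : ∀ n, Lp ℂ p (μ n),
      S (elemTensor G ξ) = T (elemTensor G ξ)) : S = T :=
  LpOp.ext_elemTensor hp {i} fun G hG => h G (Finset.singleton_subset_iff.1 hG)

/-- `amplify` as a unital homomorphism. -/
def amplifyHom (hp : p ≠ ∞) (i : ℕ) : LpOp p (μ i) →ₐ[ℂ] LpOp p (Measure.infinitePi μ) :=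
  AlgHom.ofLinearMap
    { toFun := amplify i
      map_add' := fun S T => LpOp.ext_elemTensor_of_mem hp i fun G hi ξ => by
        rw [add_apply, amplify_elemTensor hp _ hi, amplify_elemTensor hp _ hi,
          amplify_elemTensor hp _ hi, add_apply, elemTensor_update_add hi]
      map_smul' := fun c T => LpOp.ext_elemTensor_of_mem hp i fun G hi ξ => by
        rw [smul_apply, amplify_elemTensor hp _ hi, amplify_elemTensor hp _ hi, smul_apply,
          elemTensor_update_smul hi, RingHom.id_apply] }
    (LpOp.ext_elemTensor_of_mem hp i fun G hi ξ => by simp [amplify_elemTensor hp _ hi])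
    (fun S T => LpOp.ext_elemTensor_of_mem hp i fun G hi ξ => by
      simp [amplify_elemTensor hp _ hi])

theorem norm_amplifyHom_le (hp : p ≠ ∞) (i : ℕ) (T : LpOp p (μ i)) :
    ‖amplifyHom hp i T‖ ≤ ‖T‖ := norm_amplify_le hp i T

theorem amplifyHom_elemTensor (hp : p ≠ ∞) {i : ℕ} (T : LpOp p (μ i)) {G : Finset ℕ} (hi : i ∈ G)
    (ξ : ∀ n, Lp ℂ p (μ n)) :
    amplifyHom hp i T (elemTensor G ξ) = elemTensor G (Function.update ξ i (T (ξ i))) :=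
  amplify_elemTensor hp T hi ξ

theorem commute_amplifyHom (hp : p ≠ ∞) {i j : ℕ} (hij : i ≠ j) (S : LpOp p (μ i))
    (T : LpOp p (μ j)) : Commute (amplifyHom hp i S) (amplifyHom hp j T) := by
  refine LpOp.ext_elemTensor hp {i, j} fun G hG ξ => ?_
  have hi : i ∈ G := hG (by simp)
  have hj : j ∈ G := hG (by simp)
  simp only [mul_apply_eq_comp, amplifyHom_elemTensor hp _ hi,
    amplifyHom_elemTensor hp _ hj, Function.update_of_ne hij, Function.update_of_ne hij.symm]
  rw [Function.update_comm hij]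

/-- Totality of the elementary tensors with `F ⊆ G`. This identifies an operator known only through
its action on them with an explicit product of amplifications. -/
theorem IsTensorOp.unique (hp : p ≠ ∞) {F : Finset ℕ} {T : ∀ n, LpOp p (μ n)}
    {R S : LpOp p (Measure.infinitePi μ)} (hR : IsTensorOp F T R) (hS : IsTensorOp F T S) :
    R = S :=
  LpOp.ext_elemTensor hp F fun G hG ξ => (hR G hG ξ).trans (hS G hG ξ).symm

theorem isTensorOp_empty (T : ∀ n, LpOp p (μ n)) : IsTensorOp ∅ T 1 := fun G _ ξ => by simp

theorem IsTensorOp.amplifyHom_mul (hp : p ≠ ∞) {F : Finset ℕ} {T : ∀ n, LpOp p (μ n)}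
    {S : LpOp p (Measure.infinitePi μ)} (hS : IsTensorOp F T S) {i : ℕ} (hi : i ∉ F) :
    IsTensorOp (insert i F) T (amplifyHom hp i (T i) * S) := fun G hG ξ => by
  rw [mul_apply_eq_comp, hS G ((Finset.subset_insert i F).trans hG),
    amplifyHom_elemTensor hp _ (hG (Finset.mem_insert_self i F))]
  refine elemTensor_congr fun n _ => ?_
  by_cases hn : n = i
  · subst hn
    simp [hi]
  · simp [hn]

theorem isTensorOp_amplifyHom (hp : p ≠ ∞) {F : Finset ℕ} {T : ∀ n, LpOp p (μ n)} {i : ℕ}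
    (hi : i ∈ F) (hT : ∀ n ≠ i, T n = 1) : IsTensorOp F T (amplifyHom hp i (T i)) :=
  fun G hG ξ => by
  rw [amplifyHom_elemTensor hp _ (hG hi)]
  refine elemTensor_congr fun n _ => ?_
  by_cases hn : n = i
  · subst hn
    simp [hi]
  · simp [hn, hT n hn]

end Amplification

/-! ## Signed permutation matrices -/

section SignedPerm

variable {p : ℝ≥0∞} [Fact (1 ≤ p)] {d : ℕ}

/-- The signed permutation matrix `f ↦ (sᵢ f(π i))ᵢ`. -/
def signedPerm (s : Fin d → ℤˣ) (π : Equiv.Perm (Fin d)) : MatLp p d :=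
  LinearMap.toContinuousLinearMap
    { toFun := fun f => WithLp.toLp p fun i => ((s i : ℤ) : ℂ) * f (π i)
      map_add' := fun f g => by ext i; simp [mul_add]
      map_smul' := fun c f => by ext i; simp [mul_left_comm] }

theorem signedPerm_apply (s : Fin d → ℤˣ) (π : Equiv.Perm (Fin d))
    (f : PiLp p (fun _ : Fin d => ℂ)) (i : Fin d) :
    (signedPerm s π : MatLp p d) f i = ((s i : ℤ) : ℂ) * f (π i) := rfl

/-- The matrices pull indices back, so the permutations compose in reverse order. -/
theorem signedPerm_mul (s t : Fin d → ℤˣ) (π σ : Equiv.Perm (Fin d)) :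
    (signedPerm s π * signedPerm t σ : MatLp p d) = signedPerm (s * t ∘ π) (σ * π) := by
  ext f i
  simp [signedPerm_apply, mul_assoc]

theorem signedPerm_one : (signedPerm 1 1 : MatLp p d) = 1 := by
  ext f i
  simp [signedPerm_apply]

theorem norm_signedPerm_le (hp : p ≠ ∞) (s : Fin d → ℤˣ) (π : Equiv.Perm (Fin d)) :
    ‖(signedPerm s π : MatLp p d)‖ ≤ 1 := by
  have hp0 : 0 < p.toReal :=
    ENNReal.toReal_pos (zero_lt_one.trans_le (Fact.out : 1 ≤ p)).ne' hp
  refine ContinuousLinearMap.opNorm_le_bound _ zero_le_one fun f => ?_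
  rw [one_mul, PiLp.norm_eq_sum hp0, PiLp.norm_eq_sum hp0,
    ← Equiv.sum_comp π fun i => ‖f i‖ ^ p.toReal]
  refine le_of_eq (congrArg (· ^ (1 / p.toReal)) (Finset.sum_congr rfl fun i _ => ?_))
  rw [signedPerm_apply, norm_mul]
  rcases Int.units_eq_one_or (s i) with h | h <;> simp [h]

/-- Signed permutation matrices as units. -/
def signedPermUnit (s : Fin d → ℤˣ) (π : Equiv.Perm (Fin d)) : (MatLp p d)ˣ where
  val := signedPerm s π
  -- Signs are their own inverses, so the signs `t` of the inverse must satisfy `t ∘ π = s`.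
  inv := signedPerm (s ∘ ⇑π⁻¹) π⁻¹
  val_inv := by
    rw [signedPerm_mul, ← signedPerm_one]
    congr 1
    · ext i; simp
    · simp
  inv_val := by
    rw [signedPerm_mul, ← signedPerm_one]
    congr 1
    · ext i; simp
    · simp

variable (p d) in
/-- The group of signed permutation matrices. -/
def signedPermGroup : Subgroup (MatLp p d)ˣ where
  carrier := Set.range fun g : (Fin d → ℤˣ) × Equiv.Perm (Fin d) => signedPermUnit g.1 g.2
  mul_mem' := by
    rintro _ _ ⟨⟨s, π⟩, rfl⟩ ⟨⟨t, σ⟩, rfl⟩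
    exact ⟨(s * t ∘ π, σ * π), Units.ext (signedPerm_mul s t π σ).symm⟩
  one_mem' := ⟨(1, 1), Units.ext signedPerm_one⟩
  inv_mem' := by
    rintro _ ⟨⟨s, π⟩, rfl⟩
    exact ⟨(s ∘ ⇑π⁻¹, π⁻¹), Units.ext rfl⟩

instance : Finite (signedPermGroup p d) :=
  (Set.finite_range fun g : (Fin d → ℤˣ) × Equiv.Perm (Fin d) =>
    (signedPermUnit g.1 g.2 : (MatLp p d)ˣ)).to_subtype

theorem norm_le_one_of_mem_signedPermGroup (hp : p ≠ ∞) {u : (MatLp p d)ˣ}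
    (hu : u ∈ signedPermGroup p d) : ‖(u : MatLp p d)‖ ≤ 1 := by
  obtain ⟨g, rfl⟩ := hu
  exact norm_signedPerm_le hp _ _

/-- Signs are needed: permutation matrices alone span only matrices whose row and column sums all
agree. With signs, every matrix unit is a combination of two group elements. -/
theorem span_signedPermGroup :
    Submodule.span ℂ (Units.val '' (signedPermGroup p d : Set (MatLp p d)ˣ)) = ⊤ := by
  refine eq_top_iff.2 fun T _ => ?_
  let b := PiLp.basisFun p ℂ (Fin d)
  have hmem : ∀ s π, (signedPerm s π : MatLp p d) ∈
      Submodule.span ℂ (Units.val '' (signedPermGroup p d : Set (MatLp p d)ˣ)) := fun s π =>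
    Submodule.subset_span ⟨signedPermUnit s π, ⟨(s, π), rfl⟩, rfl⟩
  -- The two matrices differ only by the sign in row `i`, whose nonzero entry sits in column `j`;
  -- half their difference is the matrix unit at `(i, j)`.
  let E : Fin d → Fin d → MatLp p d := fun i j => (2⁻¹ : ℂ) • (signedPerm 1 (Equiv.swap i j) -
    signedPerm (Function.update 1 i (-1)) (Equiv.swap i j))
  have hE : ∀ i j f k, E i j f k = if k = i then f j else 0 := by
    intro i j f k
    have h : E i j f k = 2⁻¹ * (signedPerm 1 (Equiv.swap i j) f k -
      signedPerm (Function.update 1 i (-1)) (Equiv.swap i j) f k) := rfl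
    rw [h, signedPerm_apply, signedPerm_apply]
    by_cases hk : k = i
    · subst hk
      simp
      ring
    · simp [hk]
  have hT : T = ∑ j, ∑ i, T (b j) i • E i j := by
    ext f k
    have hf : T f k = ∑ j, f j * T (b j) k := by
      conv_lhs => rw [← b.sum_repr f]
      simp [b]
    rw [hf]
    simp only [sum_apply, smul_apply, WithLp.ofLp_sum, Finset.sum_apply, WithLp.ofLp_smul,
      Pi.smul_apply, hE]
    simp [mul_comm]
  rw [hT]
  exact Submodule.sum_mem _ fun i _ => Submodule.sum_mem _ fun j _ =>
    Submodule.smul_mem _ _ (Submodule.smul_mem _ _ (Submodule.sub_mem _ (hmem _ _) (hmem _ _)))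

end SignedPerm

/-! ### Finite groups generated by commuting subgroups, and contractive units -/

section Groups

/-- Commuting subgroups generate the image of their direct product under multiplication. -/
theorem Subgroup.finite_iSup_of_commute {G ι : Type*} [Group G] [Finite ι] (H : ι → Subgroup G)
    [∀ i, Finite (H i)]
    (hcomm : Pairwise fun i j => ∀ x y : G, x ∈ H i → y ∈ H j → Commute x y) :
    Finite (⨆ i, H i : Subgroup G) := by
  have := Fintype.ofFinite ι
  rw [← Subgroup.noncommPiCoprod_range (hcomm := hcomm)]
  exact Finite.of_surjective _ (MonoidHom.rangeRestrict_surjective _)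

/-- The group of units `u` of a normed ring with `‖u‖ ≤ 1` and `‖u⁻¹‖ ≤ 1`. -/
def contractiveUnits (A : Type*) [NormedRing A] (h : ‖(1 : A)‖ ≤ 1) : Subgroup Aˣ where
  carrier := {u | ‖(u : A)‖ ≤ 1 ∧ ‖((u⁻¹ : Aˣ) : A)‖ ≤ 1}
  mul_mem' := by
    rintro u v ⟨hu, hu'⟩ ⟨hv, hv'⟩
    refine ⟨(norm_mul_le _ _).trans (mul_le_one₀ hu (norm_nonneg _) hv), ?_⟩
    rw [mul_inv_rev]
    exact (norm_mul_le _ _).trans (mul_le_one₀ hv' (norm_nonneg _) hu')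
  one_mem' := ⟨h, by simpa using h⟩
  inv_mem' := by
    rintro u ⟨hu, hu'⟩
    exact ⟨hu', by simpa using hu⟩

end Groups

/-! ### Finite groups spanning the stages -/

section Stages

variable {A : Type u} [NormedRing A] [NormedAlgebra ℂ A]

/-- A group is closed under products, so its linear span is already an algebra. -/
theorem Submodule.span_units_eq_adjoin (K : Subgroup Aˣ) :
    Submodule.span ℂ (Units.val '' (K : Set Aˣ)) =
      (Algebra.adjoin ℂ (Units.val '' (K : Set Aˣ))).toSubmodule := by
  have : (Units.val '' (K : Set Aˣ)) = (K.toSubmonoid.map (Units.coeHom A) : Set A) := rfl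
  rw [Algebra.adjoin_eq_span, this, Submonoid.closure_eq]

variable {p : ℝ≥0∞} [Fact (1 ≤ p)] {d : ℕ → ℕ} (ψ : ∀ n, MatLp p (d n) →ₐ[ℂ] A)

/-- The group of units generated by the images of the signed permutation matrices under the first
`n` homomorphisms `ψᵢ`. -/
def stageGroup (n : ℕ) : Subgroup Aˣ :=
  ⨆ i : Fin n, (signedPermGroup p (d i)).map (Units.map (ψ i : MatLp p (d i) →* A))

theorem stageGroup_mono : Monotone (stageGroup ψ) := fun _ n h =>
  iSup_le fun i => le_iSup (fun i : Fin n =>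
    (signedPermGroup p (d i)).map (Units.map (ψ i : MatLp p (d i) →* A))) (Fin.castLE h i)

theorem finite_stageGroup (hcomm : ∀ i j, i ≠ j → ∀ a b, Commute (ψ i a) (ψ j b)) (n : ℕ) :
    Finite (stageGroup ψ n) := by
  have : ∀ i : Fin n, Finite
      ((signedPermGroup p (d i)).map (Units.map (ψ i : MatLp p (d i) →* A))) := fun i =>
    ((Set.finite_coe_iff.1 (inferInstanceAs (Finite (signedPermGroup p (d i))))).image _).to_subtype
  refine Subgroup.finite_iSup_of_commute _ fun i j hij => ?_
  rintro _ _ ⟨x, -, rfl⟩ ⟨y, -, rfl⟩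
  exact Units.ext (hcomm i j (fun h => hij (Fin.ext h)) x y)

/-- Contractive units with contractive inverse form a subgroup, so only the generators have to be
checked. -/
theorem norm_le_one_of_mem_stageGroup (hp : p ≠ ∞) (hone : ‖(1 : A)‖ ≤ 1)
    (hψ : ∀ n a, ‖ψ n a‖ ≤ ‖a‖) (n : ℕ) {u : Aˣ} (hu : u ∈ stageGroup ψ n) : ‖(u : A)‖ ≤ 1 := by
  suffices h : stageGroup ψ n ≤ contractiveUnits A hone from (h hu).1
  refine iSup_le fun i => ?_
  rw [Subgroup.map_le_iff_le_comap]
  intro x hx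
  have h1 := (hψ i _).trans (norm_le_one_of_mem_signedPermGroup hp hx)
  have h2 := (hψ i _).trans (norm_le_one_of_mem_signedPermGroup hp (inv_mem hx))
  rw [Subgroup.mem_comap]
  exact ⟨h1, h2⟩

/-- The linear span of the `n`-th stage group, as a subalgebra. -/
def stageAlgebra (n : ℕ) : Subalgebra ℂ A :=
  Algebra.adjoin ℂ (Units.val '' (stageGroup ψ n : Set Aˣ))

theorem mem_stageAlgebra {i n : ℕ} (hi : i < n) (a : MatLp p (d i)) :
    ψ i a ∈ stageAlgebra ψ n := by
  have h : Submodule.span ℂ (Units.val '' (signedPermGroup p (d i) : Set (MatLp p (d i))ˣ)) ≤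
      (stageAlgebra ψ n).toSubmodule.comap (ψ i).toLinearMap := by
    rw [Submodule.span_le]
    rintro _ ⟨u, hu, rfl⟩
    refine Algebra.subset_adjoin ⟨Units.map (ψ i : MatLp p (d i) →* A) u, ?_, rfl⟩
    exact Subgroup.mem_iSup_of_mem (⟨i, hi⟩ : Fin n) (Subgroup.mem_map_of_mem _ hu)
  rw [span_signedPermGroup] at h
  exact h Submodule.mem_top

theorem amenable_of_dense_stageAlgebra (hp : p ≠ ∞) (hone : ‖(1 : A)‖ ≤ 1)
    (hψ : ∀ n a, ‖ψ n a‖ ≤ ‖a‖) (hcomm : ∀ i j, i ≠ j → ∀ a b, Commute (ψ i a) (ψ j b))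
    (hdense : Dense (⋃ n, (stageAlgebra ψ n : Set A))) :
    IsAmenable.{u, w} A ∧ IsCAmenable 1 A := by
  have := finite_stageGroup ψ hcomm
  have hd : Dense (⋃ n, (Submodule.span ℂ (Units.val '' (stageGroup ψ n : Set Aˣ)) : Set A)) := by
    simpa only [Submodule.span_units_eq_adjoin, Subalgebra.coe_toSubmodule, stageAlgebra] using hdense
  exact ⟨isAmenable_of_finite_subgroups _ (stageGroup_mono ψ)
      (fun n _ => norm_le_one_of_mem_stageGroup ψ hp hone hψ n) hd,
    isCAmenable_one_of_finite_subgroups _ (stageGroup_mono ψ)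
      (fun n _ => norm_le_one_of_mem_stageGroup ψ hp hone hψ n) hd⟩

end Stages

/-! ### Application to `A(d, ρ)` -/

section UHF

variable {p : ℝ≥0∞} [Fact (1 ≤ p)] {Y : ℕ → Type v} [∀ n, MeasurableSpace (Y n)]
  {ν : ∀ n, Measure (Y n)} [∀ n, IsProbabilityMeasure (ν n)] {d : ℕ → ℕ}
  (ρ : ∀ n, MatLp p (d n) →ₐ[ℂ] LpOp p (ν n))

theorem tensorStage_le_tensorUHF (n : ℕ) : tensorStage ρ n ≤ tensorUHF ρ :=
  (le_iSup (tensorStage ρ) n).trans (Subalgebra.le_topologicalClosure _)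

/-- The embedding of the `i`-th matrix algebra into `A(d, ρ)`. -/
def tensorUHF.embed (hp : p ≠ ∞) (i : ℕ) : MatLp p (d i) →ₐ[ℂ] tensorUHF ρ :=
  ((amplifyHom hp i).comp (ρ i)).codRestrict _ fun a => by
    -- Stage `i + 1` is the first whose coordinates include `i`; the other matrices are taken to be
    -- `1`.
    refine tensorStage_le_tensorUHF ρ (i + 1) (Algebra.subset_adjoin ⟨Function.update 1 i a, ?_⟩)
    have h := isTensorOp_amplifyHom hp (F := Finset.range (i + 1))
      (T := fun n => ρ n (Function.update (1 : ∀ n, MatLp p (d n)) i a n)) (i := i)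
      (Finset.self_mem_range_succ i) fun n hn => by simp [hn]
    simpa using h

/-- A generator of the stage is given only by its action on elementary tensors. The product of the
amplifications of its factors, built one coordinate at a time inside `B`, has the same action and so
equals it. -/
theorem tensorUHF.tensorStage_le (hp : p ≠ ∞) {B : Subalgebra ℂ (LpOp p (Measure.infinitePi ν))}
    {n : ℕ} (hB : ∀ i < n, ∀ a, amplifyHom hp i (ρ i a) ∈ B) : tensorStage ρ n ≤ B := by
  refine Algebra.adjoin_le ?_
  rintro S ⟨a, hS⟩
  have h : ∀ m ≤ n, ∃ R ∈ B, IsTensorOp (Finset.range m) (fun i => ρ i (a i)) R := by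
    intro m
    induction m with
    | zero => exact fun _ => ⟨1, B.one_mem, isTensorOp_empty _⟩
    | succ m ih =>
      intro hm
      obtain ⟨R, hR, hRt⟩ := ih (Nat.le_of_succ_le hm)
      refine ⟨_, B.mul_mem (hB m hm (a m)) hR, ?_⟩
      rw [Finset.range_add_one]
      exact hRt.amplifyHom_mul hp Finset.notMem_range_self
  obtain ⟨R, hR, hRt⟩ := h n le_rfl
  rwa [SetLike.mem_coe, hS.unique hp hRt]

theorem tensorUHF.dense_stageAlgebra (hp : p ≠ ∞) {A : Type u} [NormedRing A] [NormedAlgebra ℂ A]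
    (e : A ≃ₐ[ℂ] tensorUHF ρ) (he : Isometry e) :
    Dense (⋃ n, (stageAlgebra (fun i => (e.symm : tensorUHF ρ →ₐ[ℂ] A).comp
      (tensorUHF.embed ρ hp i)) n : Set A)) := by
  set ψ : ∀ n, MatLp p (d n) →ₐ[ℂ] A := fun i => (e.symm : tensorUHF ρ →ₐ[ℂ] A).comp
      (tensorUHF.embed ρ hp i)
  let f : A →ₐ[ℂ] LpOp p (Measure.infinitePi ν) := (tensorUHF ρ).val.comp e
  let B : ℕ → Subalgebra ℂ (LpOp p (Measure.infinitePi ν)) := fun n => (stageAlgebra ψ n).map f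
  have hBmono : Monotone B := fun m n h => Subalgebra.map_mono (Algebra.adjoin_mono
    (Set.image_mono (stageGroup_mono ψ h)))
  have hle : ⨆ n, tensorStage ρ n ≤ ⨆ n, B n := by
    refine iSup_mono fun n => tensorUHF.tensorStage_le ρ hp fun i hi a => ?_
    refine ⟨ψ i a, mem_stageAlgebra ψ hi a, ?_⟩
    simp [f, ψ, tensorUHF.embed]
  rw [Metric.dense_iff]
  intro x ε hε
  have hx : (e x : LpOp p (Measure.infinitePi ν)) ∈
      closure ((⨆ n, tensorStage ρ n : Subalgebra ℂ _) : Set (LpOp p (Measure.infinitePi ν))) :=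
    (e x).2
  obtain ⟨y, hy, hxy⟩ := Metric.mem_closure_iff.1 (closure_mono hle hx) ε hε
  -- The stages increase, so their supremum is their union and the approximant lies in a single one.
  rw [Subalgebra.coe_iSup_of_directed hBmono.directed_le] at hy
  obtain ⟨n, b, hb, rfl⟩ := Set.mem_iUnion.1 hy
  refine ⟨b, ?_, Set.mem_iUnion.2 ⟨n, hb⟩⟩
  rw [Metric.mem_ball, dist_comm, ← he.dist_eq]
  exact hxy

theorem tensorUHF.amenable_of_isometry (hp : p ≠ ∞) (hρ : ∀ n, IsSpatialRep (ρ n)) {A : Type u}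
    [NormedRing A] [NormedAlgebra ℂ A] (e : A ≃ₐ[ℂ] tensorUHF ρ) (he : Isometry e) :
    CompleteSpace A ∧ IsAmenable.{u, w} A ∧ IsCAmenable 1 A := by
  have hnorm : ∀ x, ‖e x‖ = ‖x‖ := he.norm_map_of_map_zero (map_zero e)
  have hnorm' : ∀ x, ‖e.symm x‖ = ‖x‖ := fun x => by rw [← hnorm, e.apply_symm_apply]
  have hone : ‖(1 : A)‖ ≤ 1 := by
    rw [← hnorm, map_one]
    exact ContinuousLinearMap.norm_id_le
  refine ⟨?_, amenable_of_dense_stageAlgebra _ hp hone (fun n a => ?_)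
    (fun i j hij a b => ?_) (tensorUHF.dense_stageAlgebra ρ hp e he)⟩
  · have : CompleteSpace (tensorUHF ρ) :=
      (Subalgebra.isClosed_topologicalClosure _).completeSpace_coe
    exact (completeSpace_congr (e := e.toEquiv) he.isUniformEmbedding).2 this
  · exact (hnorm' _).trans_le ((norm_amplifyHom_le hp n (ρ n a)).trans (hρ n a))
  · have h : Commute (tensorUHF.embed ρ hp i a) (tensorUHF.embed ρ hp j b) :=
      Subtype.ext (commute_amplifyHom hp hij (ρ i a) (ρ j b))
    exact h.map e.symm

end UHF

end

theorem mainTheorem4 (p : ℝ≥0∞) [Fact (1 ≤ p)] (hp : p ≠ ∞)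
    {X : Type u} [MeasurableSpace X] (μ : Measure X) [SigmaFinite μ]
    (A : Subalgebra ℂ (LpOp p μ)) (hA : IsSpatialLpUHF.{u, v} A) :
    CompleteSpace A ∧ IsAmenable.{u, w} A ∧ IsCAmenable 1 A := by
  obtain ⟨d, Y, _, ν, _, ρ, -, hρ, e, he⟩ := hA
  exact tensorUHF.amenable_of_isometry ρ hp hρ e he
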